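/- Let $n$ and $m$ denote positive integers. For a non-empty subset $A$ of $\mathbb Z_n=\mathbb Z/n\mathbb Z$, let $C_A(n)$ be the least positive integer $k$ such that every sequence $(x_1,\dots,x_k)$ of length $k$ in $\mathbb Z_n$ has an $A$-weighted zero-sum subsequence of consecutive terms, i.e. there are $1\le i\le j\le k$ and $a_i,\dots,a_j\in A$ with $a_ix_i+a_{i+1}x_{i+1}+\cdots+a_jx_j=0$. Let $U(n)$ be the group of units of $\mathbb Z_n$ and $U(n)^3=\{x^3: x\in U(n)\}$. Let $\Omega(n)$ be the number of prime factors of $n$ counted with multiplicity. For a positive integer $n$ with $7\nmid n$ write $n=n_1n_2$, where $n_1$ is the product of the prime powers $p^{v_p(n)}$ over all primes $p\mid n$ with $p\equiv 1 \pmod 3$, and $n_2=n/n_1$. (a) If $n$ is not divisible by $2$, $3$ or $7$, then $$C_{U(n)^3}(n)\le 2^{\Omega(n_2)}\,4^{\Omega(n_1)}.$$ (b) If $m=7^r n$ with $r\ge 0$ and $7\nmid n$, then $$C_{U(m)^3}(m)\ge 2^{\Omega(n_2)}\,3^{\Omega(n_1)}\,4^{r}.$$ -/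

import Mathlib

/-- The part of the sequence `x` indexed by the finite set `s` is an `A`-weighted zero-sum sequence:
weights from `A` can be chosen for its terms so that the weighted sum is `0`. -/
def IsWeightedZeroSumOn {R M ι : Type*} [Ring R] [AddCommGroup M] [Module R M]
    (A : Set R) (s : Finset ι) (x : ι → M) : Prop :=
  ∃ a : ι → R, (∀ i ∈ s, a i ∈ A) ∧ ∑ i ∈ s, a i • x i = 0

/-- The sequence `x = (x 0, …, x (k - 1))` has a (non-empty) `A`-weighted zero-sum subsequence of
consecutive terms `(x i, …, x j)`. -/
def HasConsecutiveWeightedZeroSum {R M : Type*} [Ring R] [AddCommGroup M] [Module R M]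
    (A : Set R) {k : ℕ} (x : Fin k → M) : Prop :=
  ∃ i j : Fin k, i ≤ j ∧ IsWeightedZeroSumOn A (Finset.Icc i j) x

/-- The constant `C_A(M)`: the least positive integer `k` such that every sequence in `M` of
length `k` has an `A`-weighted zero-sum subsequence of consecutive terms. -/
noncomputable def weightedC {R : Type*} [Ring R] (A : Set R) (M : Type*) [AddCommGroup M]
    [Module R M] : ℕ :=
  sInf {k : ℕ | 0 < k ∧ ∀ x : Fin k → M, HasConsecutiveWeightedZeroSum A x}

/-- For finite `M` and non-empty `A` the set in the definition of `weightedC` is non-empty,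
so that `weightedC` is a genuine least element. -/
theorem weightedC_isLeast {R M : Type*} [Ring R] [AddCommGroup M] [Module R M] [Finite M]
    (A : Set R) (hA : A.Nonempty) :
    IsLeast {k : ℕ | 0 < k ∧ ∀ x : Fin k → M, HasConsecutiveWeightedZeroSum A x}
      (weightedC A M) := by
  classical
  have : Fintype M := Fintype.ofFinite M
  obtain ⟨c, hc⟩ := hA
  have hne : {k : ℕ | 0 < k ∧ ∀ x : Fin k → M, HasConsecutiveWeightedZeroSum A x}.Nonempty := by
    refine ⟨Fintype.card M, Fintype.card_pos, fun x => ?_⟩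
    let P : Fin (Fintype.card M + 1) → M := fun t => ∑ s with s.val < t.val, x s
    obtain ⟨t₁, t₂, hne, hP⟩ := Fintype.exists_ne_map_eq_of_card_lt P (by simp)
    wlog hlt : t₁ < t₂ generalizing t₁ t₂
    · exact this t₂ t₁ hne.symm hP.symm (lt_of_le_of_ne (not_lt.mp hlt) hne.symm)
    have h12 : t₁.val < t₂.val := hlt
    have h2 : t₂.val < Fintype.card M + 1 := t₂.isLt
    let i : Fin (Fintype.card M) := ⟨t₁.val, by omega⟩
    let j : Fin (Fintype.card M) := ⟨t₂.val - 1, by omega⟩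
    refine ⟨i, j, Fin.mk_le_mk.mpr (by omega), fun _ => c, fun _ _ => hc, ?_⟩
    rw [← Finset.smul_sum]
    have hsplit : P t₂ = P t₁ + ∑ s ∈ Finset.Icc i j, x s := by
      rw [← Finset.sum_union]
      · refine Finset.sum_congr ?_ fun _ _ => rfl
        ext s
        simp only [Finset.mem_filter, Finset.mem_univ, true_and, Finset.mem_union,
          Finset.mem_Icc, Fin.le_def, i, j]
        omega
      · rw [Finset.disjoint_left]
        intro s
        simp only [Finset.mem_filter, Finset.mem_univ, true_and, Finset.mem_Icc, Fin.le_def, i, j]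
        omega
    have h0 : ∑ s ∈ Finset.Icc i j, x s = 0 := by
      rw [hP] at *
      simpa using hsplit
    rw [h0, smul_zero]
  exact ⟨Nat.sInf_mem hne, fun k hk => Nat.sInf_le hk⟩

/-- The set `U(n)^j` of `j`-th powers of units of `ℤ/nℤ`. -/
def unitPowers (n j : ℕ) : Set (ZMod n) :=
  {y | ∃ u : (ZMod n)ˣ, y = (u : ZMod n) ^ j}

/-- `n₁`: the product of the full prime powers `p ^ v_p(n)` over the prime divisors `p` of `n`
with `p ≡ 1 (mod 3)`. -/
def oneModThreePart (n : ℕ) : ℕ :=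
  ∏ p ∈ n.primeFactors with p ≡ 1 [MOD 3], p ^ n.factorization p

/-- `n₂ = n / n₁` (an exact division, see `oneModThreePart_mul_coPart`). -/
def oneModThreeCoPart (n : ℕ) : ℕ :=
  n / oneModThreePart n

theorem oneModThreePart_mul_coPart (n : ℕ) :
    oneModThreePart n * oneModThreeCoPart n = n := by
  rcases eq_or_ne n 0 with rfl | hn
  · simp [oneModThreeCoPart]
  · refine Nat.mul_div_cancel' ?_
    conv_rhs => rw [← Nat.prod_factorization_pow_eq_self hn]
    exact Finset.prod_dvd_prod_of_subset _ _ _ (Finset.filter_subset _ _)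

/-!
Everything is transported to integer sequences: `x` is a zero-sum modulo `n` if
`n ∣ ∑ u i ^ 3 * x i` for integers `u i` prime to `n`.

*Upper bound.* Let `c p` be `4` for `p ≡ 1 (mod 3)` and `2` otherwise. If, for every prime `p ∣ n`,
at least `c p` terms are prime to `p`, the whole sequence is a zero-sum
(`isCubeZeroSumOn_of_cubeThreshold_le`): modulo `p` the non-zero cubes form a set of size at least
`(p - 1) / 3`, respectively exactly `p - 1`, and Cauchy–Davenport shows that the weighted sums of
`c p` non-zero terms fill `ℤ/p`, because `p ≠ 2, 7`; such a zero-sum lifts to powers of `p ≠ 3`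
since units `≡ 1 (mod p)` are cubes; and the prime powers are combined by the Chinese remainder
theorem. Otherwise some prime `p` has fewer than `c p` terms prime to it. The sequence is cut into
`c p` consecutive blocks, one of which consists of multiples of `p`; dividing that block by `p`
leads to the modulus `n / p`, and the bound follows by induction
(`ForcesCubeZeroSum.exists_of_card_lt`).

*Lower bound.* Interleaving a sequence modulo `p` with copies of `p` times a sequence modulo `n`
shows that the constant is supermultiplicative (`not_forcesCubeZeroSum_mul`), so it suffices to
give short sequences without zero-sums modulo primes: `1` in general, `1, w` with `w` a non-cube
for `p ≡ 1 (mod 3)`, and `1, 3, 1` modulo `7`.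
-/

/-! ### Cube-weighted zero-sums of integers -/

/-- The terms of the integer sequence `x` indexed by `s` form a zero-sum sequence modulo `n` when
weighted by cubes of integers coprime to `n`. This is `U(n)³`-weighted zero-sum on integer
representatives (`isWeightedZeroSumOn_unitPowers_iff`), which allows passing between moduli. -/
def IsCubeZeroSumOn {ι : Type*} (n : ℕ) (s : Finset ι) (x : ι → ℤ) : Prop :=
  ∃ u : ι → ℤ, (∀ i ∈ s, IsCoprime (n : ℤ) (u i)) ∧ (n : ℤ) ∣ ∑ i ∈ s, u i ^ 3 * x i

theorem isWeightedZeroSumOn_unitPowers_iff {ι : Type*} (n : ℕ) (s : Finset ι) (x : ι → ℤ) :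
    IsWeightedZeroSumOn (unitPowers n 3) s (fun i => (x i : ZMod n)) ↔ IsCubeZeroSumOn n s x := by
  classical
  constructor
  · rintro ⟨a, ha, hsum⟩
    have h : ∀ i, ∃ u : ℤ, i ∈ s → IsCoprime (n : ℤ) u ∧ a i = (u : ZMod n) ^ 3 := by
      intro i
      by_cases hi : i ∈ s
      · obtain ⟨v, hv⟩ := ha i hi
        obtain ⟨u, hu⟩ := ZMod.intCast_surjective (v : ZMod n)
        refine ⟨u, fun _ => ⟨?_, by rw [hv, hu]⟩⟩
        rw [← ZMod.coe_int_isUnit_iff_isCoprime, hu]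
        exact v.isUnit
      · exact ⟨0, fun h => absurd h hi⟩
    choose u hu using h
    refine ⟨u, fun i hi => (hu i hi).1, ?_⟩
    rw [← ZMod.intCast_zmod_eq_zero_iff_dvd]
    push_cast
    rw [← hsum]
    exact Finset.sum_congr rfl fun i hi => by rw [(hu i hi).2, smul_eq_mul]
  · rintro ⟨u, hu, hsum⟩
    refine ⟨fun i => (u i : ZMod n) ^ 3, fun i hi => ?_, ?_⟩
    · obtain ⟨v, hv⟩ := (ZMod.coe_int_isUnit_iff_isCoprime (u i) n).2 (hu i hi)
      exact ⟨v, by rw [hv]⟩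
    · rw [← ZMod.intCast_zmod_eq_zero_iff_dvd] at hsum
      push_cast at hsum
      simpa using hsum

theorem IsCubeZeroSumOn.map {ι κ : Type*} {n : ℕ} {s : Finset ι} (e : ι ↪ κ) {x : κ → ℤ}
    (h : IsCubeZeroSumOn n s (x ∘ e)) : IsCubeZeroSumOn n (s.map e) x := by
  obtain ⟨u, hu, hsum⟩ := h
  have he : ∀ i, Function.extend e u 0 (e i) = u i := fun i => e.injective.extend_apply u 0 i
  refine ⟨Function.extend e u 0, ?_, ?_⟩
  · intro k hk
    obtain ⟨i, hi, rfl⟩ := Finset.mem_map.1 hk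
    rw [he]
    exact hu i hi
  · simpa [Finset.sum_map, he] using hsum

theorem IsCubeZeroSumOn.comp {ι κ : Type*} {n : ℕ} {s : Finset ι} (e : ι ↪ κ) {x : κ → ℤ}
    (h : IsCubeZeroSumOn n (s.map e) x) : IsCubeZeroSumOn n s (x ∘ e) := by
  obtain ⟨u, hu, hsum⟩ := h
  refine ⟨u ∘ e, fun i hi => hu _ (Finset.mem_map_of_mem e hi), ?_⟩
  simpa [Finset.sum_map] using hsum

/-- Every integer sequence of length `k` has a non-empty stretch of consecutive terms that is a
cube-weighted zero-sum modulo `n`; `Finset.Ico a b` is the stretch. -/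
def ForcesCubeZeroSum (n k : ℕ) : Prop :=
  ∀ x : ℕ → ℤ, ∃ a b, a < b ∧ b ≤ k ∧ IsCubeZeroSumOn n (Finset.Ico a b) x

theorem hasConsecutiveWeightedZeroSum_iff (n k : ℕ) (x : ℕ → ℤ) :
    HasConsecutiveWeightedZeroSum (unitPowers n 3) (fun i : Fin k => (x i : ZMod n)) ↔
      ∃ a b, a < b ∧ b ≤ k ∧ IsCubeZeroSumOn n (Finset.Ico a b) x := by
  have hmap : ∀ i j : Fin k,
      (Finset.Icc i j).map Fin.valEmbedding = Finset.Ico (i : ℕ) (j + 1) := by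
    intro i j
    rw [Fin.map_valEmbedding_Icc]
    ext t
    simp only [Finset.mem_Icc, Finset.mem_Ico]
    omega
  constructor
  · rintro ⟨i, j, hij, h⟩
    have h' := (isWeightedZeroSumOn_unitPowers_iff n _ (x ∘ Fin.valEmbedding)).1 h
    refine ⟨i, j + 1, Nat.lt_succ_of_le hij, j.isLt, ?_⟩
    rw [← hmap]
    exact h'.map
  · rintro ⟨a, b, hab, hbk, h⟩
    refine ⟨⟨a, by omega⟩, ⟨b - 1, by omega⟩, Fin.mk_le_mk.2 (by omega), ?_⟩
    refine (isWeightedZeroSumOn_unitPowers_iff n _ (x ∘ Fin.valEmbedding)).2 (.comp _ ?_)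
    rw [hmap]
    simpa [Nat.sub_add_cancel (by omega : 1 ≤ b)] using h

theorem forcesCubeZeroSum_iff (n k : ℕ) :
    ForcesCubeZeroSum n k ↔
      ∀ x : Fin k → ZMod n, HasConsecutiveWeightedZeroSum (unitPowers n 3) x := by
  constructor
  · intro h x
    have hx : ∀ i : ℕ, ∃ z : ℤ, ∀ hi : i < k, (z : ZMod n) = x ⟨i, hi⟩ := by
      intro i
      by_cases hi : i < k
      · obtain ⟨z, hz⟩ := ZMod.intCast_surjective (x ⟨i, hi⟩)
        exact ⟨z, fun _ => hz⟩
      · exact ⟨0, fun h => absurd h hi⟩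
    choose z hz using hx
    have := (hasConsecutiveWeightedZeroSum_iff n k z).2 (h z)
    convert this using 2 with i
    exact (hz i i.isLt).symm
  · exact fun h x => (hasConsecutiveWeightedZeroSum_iff n k x).1 (h _)

theorem weightedC_unitPowers_isLeast (n : ℕ) [NeZero n] :
    IsLeast {k : ℕ | 0 < k ∧ ForcesCubeZeroSum n k} (weightedC (unitPowers n 3) (ZMod n)) := by
  simp_rw [forcesCubeZeroSum_iff]
  exact weightedC_isLeast _ ⟨1, 1, by simp⟩

/-! ### Full sequences that are zero-sums -/

/-- An integer `z ≡ 1` modulo a prime `p ≠ 3` is a cube modulo every power of `p`: the units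
congruent to `1` modulo `p` form a `p`-group, on which cubing is bijective. -/
theorem exists_pow_three_modEq {p : ℕ} (hp : p.Prime) (hp3 : p ≠ 3) (k : ℕ) {z : ℤ}
    (hz : (p : ℤ) ∣ z - 1) :
    ∃ t : ℤ, IsCoprime (p : ℤ) t ∧ ((p ^ (k + 1) : ℕ) : ℤ) ∣ t ^ 3 - z := by
  have hN : ¬ 3 ∣ p ^ k := fun h =>
    hp3 ((Nat.prime_dvd_prime_iff_eq Nat.prime_three hp).1 (Nat.prime_three.dvd_of_dvd_pow h)).symm
  obtain ⟨m, q, hmq⟩ : ∃ m q, 3 * m = 1 + p ^ k * q := by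
    rcases (by omega : p ^ k % 3 = 1 ∨ p ^ k % 3 = 2) with h | h
    · exact ⟨(1 + p ^ k * 2) / 3, 2, by omega⟩
    · exact ⟨(1 + p ^ k * 1) / 3, 1, by omega⟩
  have hpow : ((p ^ (k + 1) : ℕ) : ℤ) ∣ z ^ p ^ k - 1 := by
    simpa using dvd_sub_pow_of_dvd_sub (R := ℤ) (a := z) (b := 1) hz k
  refine ⟨z ^ m, IsCoprime.pow_right ?_, ?_⟩
  · obtain ⟨c, hc⟩ := hz
    exact ⟨-c, 1, by linarith⟩
  · have h1 : (z ^ m) ^ 3 - z = z * ((z ^ p ^ k) ^ q - 1 ^ q) := by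
      rw [← pow_mul, mul_comm m 3, hmq, pow_add, pow_mul]
      ring
    rw [h1]
    exact (hpow.trans (sub_dvd_pow_sub_pow _ _ q)).mul_left _

/-- A cube-weighted zero-sum modulo a prime `p ≠ 3` with a term prime to `p` lifts to every power
of `p`: only the weight of that term has to be changed, by a factor congruent to `1`. -/
theorem IsCubeZeroSumOn.prime_pow {ι : Type*} {p : ℕ} (hp : p.Prime) (hp3 : p ≠ 3) (k : ℕ)
    {s : Finset ι} {x : ι → ℤ} (h : IsCubeZeroSumOn p s x) {j : ι} (hj : j ∈ s)
    (hxj : ¬ (p : ℤ) ∣ x j) : IsCubeZeroSumOn (p ^ (k + 1)) s x := by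
  classical
  obtain ⟨u, hu, hsum⟩ := h
  rw [← Finset.add_sum_erase s _ hj] at hsum
  set S := ∑ i ∈ s.erase j, u i ^ 3 * x i with hS
  have hpZ : Prime (p : ℤ) := Nat.prime_iff_prime_int.1 hp
  have hxj' : IsCoprime (p : ℤ) (x j) := (hpZ.coprime_iff_not_dvd).2 hxj
  have hc : IsCoprime ((p ^ (k + 1) : ℕ) : ℤ) (u j ^ 3 * x j) := by
    push_cast
    exact ((hu j hj).pow_right.mul_right hxj').pow_left
  obtain ⟨e, w, hw⟩ := hc
  have hpdvd : (p : ℤ) ∣ ((p ^ (k + 1) : ℕ) : ℤ) := by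
    push_cast
    exact dvd_pow_self _ k.succ_ne_zero
  -- `w` inverts `u j ^ 3 * x j`, so `-S * w` is the factor by which that term has to be corrected
  have hz : (p : ℤ) ∣ -S * w - 1 := by
    have h1 : -S * w - 1 = -(w * (u j ^ 3 * x j + S)) - e * ((p ^ (k + 1) : ℕ) : ℤ) := by
      linear_combination hw
    rw [h1]
    exact dvd_sub (dvd_neg.2 (hsum.mul_left _)) (hpdvd.mul_left _)
  obtain ⟨t, ht, htz⟩ := exists_pow_three_modEq hp hp3 k hz
  refine ⟨Function.update u j (u j * t), fun i hi => ?_, ?_⟩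
  · push_cast
    apply IsCoprime.pow_left
    rcases eq_or_ne i j with rfl | hij
    · simpa using (hu i hi).mul_right ht
    · simpa [hij] using hu i hi
  · rw [← Finset.add_sum_erase s _ hj, Function.update_self]
    have h2 : ∑ i ∈ s.erase j, Function.update u j (u j * t) i ^ 3 * x i = S :=
      Finset.sum_congr rfl fun i hi => by
        rw [Function.update_of_ne (Finset.ne_of_mem_erase hi)]
    rw [h2]
    have h3 : (u j * t) ^ 3 * x j + S = (t ^ 3 - -S * w) * (u j ^ 3 * x j)
        + S * e * ((p ^ (k + 1) : ℕ) : ℤ) := by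
      linear_combination (-S) * hw
    rw [h3]
    exact dvd_add (htz.mul_right _) (Dvd.intro_left _ rfl)

/-- Iterated Cauchy–Davenport: weighted sums of `#T` non-zero residues with weights from `A` take
at least `min p (#T * (#A - 1) + 1)` values. -/
theorem exists_card_weighted_sums {ι : Type*} {p : ℕ} [Fact p.Prime] {A : Finset (ZMod p)}
    (hA : A.Nonempty) (y : ι → ZMod p) (T : Finset ι) (hy : ∀ i ∈ T, y i ≠ 0) :
    ∃ B : Finset (ZMod p), min p (T.card * (A.card - 1) + 1) ≤ B.card ∧
      ∀ b ∈ B, ∃ a : ι → ZMod p, (∀ i ∈ T, a i ∈ A) ∧ ∑ i ∈ T, a i * y i = b := by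
  classical
  open scoped Pointwise in
  induction T using Finset.induction_on with
  | empty => exact ⟨{0}, by simp, by simp⟩
  | insert j T hj ih =>
    obtain ⟨B, hB, hrep⟩ := ih fun i hi => hy i (Finset.mem_insert_of_mem hi)
    have hyj : y j ≠ 0 := hy j (Finset.mem_insert_self _ _)
    have hcard : (A.image (· * y j)).card = A.card :=
      Finset.card_image_of_injective _ (mul_left_injective₀ hyj)
    have hp := (Fact.out : p.Prime).pos
    have hBne : B.Nonempty := Finset.card_pos.1 (by omega)
    refine ⟨A.image (· * y j) + B, ?_, ?_⟩
    · have h := ZMod.cauchy_davenport Fact.out (hA.image (· * y j)) hBne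
      rw [hcard] at h
      have hA1 := hA.card_pos
      refine le_trans ?_ h
      rw [Finset.card_insert_of_notMem hj, add_mul]
      omega
    · intro b hb
      obtain ⟨c, hc, b', hb', rfl⟩ := Finset.mem_add.1 hb
      obtain ⟨α, hα, rfl⟩ := Finset.mem_image.1 hc
      obtain ⟨a, ha, rfl⟩ := hrep b' hb'
      refine ⟨Function.update a j α, fun i hi => ?_, ?_⟩
      · rcases eq_or_ne i j with rfl | hij
        · simpa using hα
        · simpa [hij] using ha i ((Finset.mem_insert.1 hi).resolve_left hij)
      · rw [Finset.sum_insert hj, Function.update_self]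
        congr 1
        refine Finset.sum_congr rfl fun i hi => ?_
        rw [Function.update_of_ne (by rintro rfl; exact hj hi)]

/-- The set of non-zero cubes modulo `p`. -/
def unitCubes (p : ℕ) [NeZero p] : Finset (ZMod p) :=
  Finset.univ.image fun v : (ZMod p)ˣ => (v : ZMod p) ^ 3

theorem le_three_mul_card_unitCubes (p : ℕ) [Fact p.Prime] : p ≤ 3 * (unitCubes p).card + 1 := by
  classical
  have h := Finset.card_le_mul_card_image (f := fun v : (ZMod p)ˣ => (v : ZMod p) ^ 3)
    Finset.univ 3 (fun b _ => by
      rw [← Finset.card_map ⟨Units.val, Units.val_injective⟩]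
      refine le_trans (Finset.card_le_card (t := (Polynomial.nthRoots 3 b).toFinset) ?_)
        ((Multiset.toFinset_card_le _).trans (Polynomial.card_nthRoots 3 b))
      intro y hy
      obtain ⟨v, hv, rfl⟩ := Finset.mem_map.1 hy
      rw [Multiset.mem_toFinset, Polynomial.mem_nthRoots three_pos]
      exact (Finset.mem_filter.1 hv).2)
  rw [Finset.card_univ, ZMod.card_units] at h
  have : (unitCubes p).card = (Finset.univ.image fun v : (ZMod p)ˣ => (v : ZMod p) ^ 3).card := rfl
  omega

theorem le_card_unitCubes {p : ℕ} [Fact p.Prime] (hp : ¬ p ≡ 1 [MOD 3]) :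
    p ≤ (unitCubes p).card + 1 := by
  have hpp : p.Prime := Fact.out
  have h2 : (p - 1).Coprime 3 := by
    refine ((Nat.Prime.coprime_iff_not_dvd Nat.prime_three).2 fun h => hp ?_).symm
    exact ((Nat.modEq_iff_dvd' hpp.one_le).2 h).symm
  have hcop : (Nat.card (ZMod p)ˣ).Coprime 3 := by
    rwa [Nat.card_eq_fintype_card, ZMod.card_units]
  have hinj : Function.Injective fun v : (ZMod p)ˣ => (v : ZMod p) ^ 3 := by
    intro v w hvw
    refine (powCoprime hcop).injective (Units.ext ?_)
    simpa using hvw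
  rw [unitCubes, Finset.card_image_of_injective _ hinj, Finset.card_univ, ZMod.card_units]
  omega

/-- The number of terms prime to `p` that guarantees a cube-weighted zero-sum modulo `p`. -/
def cubeThreshold (p : ℕ) : ℕ := if p ≡ 1 [MOD 3] then 4 else 2

/-- The Cauchy–Davenport bound for `cubeThreshold p` terms reaches `p`. For `p ≡ 1 (mod 3)` it is
`4 ((p - 1) / 3 - 1) + 1`, which is at least `p` exactly when `p ≥ 13`: hence `p ≠ 7`. -/
theorem le_cubeThreshold_mul {p : ℕ} [Fact p.Prime] (h2 : p ≠ 2) (h7 : p ≠ 7) :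
    p ≤ cubeThreshold p * ((unitCubes p).card - 1) + 1 := by
  have hpp : p.Prime := Fact.out
  have := hpp.two_le
  unfold cubeThreshold
  split_ifs with h
  · have hA := le_three_mul_card_unitCubes p
    have h' : p % 3 = 1 := h
    have h4 : p ≠ 4 := by rintro rfl; revert hpp; decide
    have h10 : p ≠ 10 := by rintro rfl; revert hpp; decide
    omega
  · have hA := le_card_unitCubes h
    omega

theorem isCubeZeroSumOn_prime {ι : Type*} {p : ℕ} (hp : p.Prime) (h2 : p ≠ 2)
    (h7 : p ≠ 7) {s : Finset ι} {x : ι → ℤ}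
    (h : cubeThreshold p ≤ {i ∈ s | ¬ (p : ℤ) ∣ x i}.card) : IsCubeZeroSumOn p s x := by
  classical
  have : Fact p.Prime := ⟨hp⟩
  set T := {i ∈ s | ¬ (p : ℤ) ∣ x i} with hT
  have hA : (unitCubes p).Nonempty := Finset.univ_nonempty.image _
  obtain ⟨B, hB, hrep⟩ := exists_card_weighted_sums hA (fun i => (x i : ZMod p)) T fun i hi h0 =>
    (Finset.mem_filter.1 hi).2 ((ZMod.intCast_zmod_eq_zero_iff_dvd _ _).1 h0)
  have hle : p ≤ T.card * ((unitCubes p).card - 1) + 1 :=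
    (le_cubeThreshold_mul h2 h7).trans (by gcongr)
  rw [min_eq_left hle] at hB
  have hBuniv : B = Finset.univ := by
    rw [← Finset.card_eq_iff_eq_univ, ZMod.card]
    exact le_antisymm ((Finset.card_le_univ B).trans (ZMod.card p).le) hB
  obtain ⟨a, ha, hsum⟩ := hrep 0 (hBuniv ▸ Finset.mem_univ _)
  rw [← isWeightedZeroSumOn_unitPowers_iff]
  refine ⟨fun i => if i ∈ T then a i else 1, fun i _ => ?_, ?_⟩
  · dsimp only
    split_ifs with hi
    · obtain ⟨v, -, hv⟩ := Finset.mem_image.1 (ha i hi)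
      exact ⟨v, hv.symm⟩
    · exact ⟨1, by simp⟩
  · rw [← hsum, ← Finset.sum_subset (Finset.filter_subset _ s : T ⊆ s)]
    · exact Finset.sum_congr rfl fun i hi => by simp [hi]
    · intro i hi hiT
      have : (p : ℤ) ∣ x i := by
        by_contra hc
        exact hiT (Finset.mem_filter.2 ⟨hi, hc⟩)
      simp [(ZMod.intCast_zmod_eq_zero_iff_dvd _ _).2 this]

theorem IsCubeZeroSumOn.mul_of_coprime {ι : Type*} {m n : ℕ} (hmn : m.Coprime n) {s : Finset ι}
    {x : ι → ℤ} (hm : IsCubeZeroSumOn m s x) (hn : IsCubeZeroSumOn n s x) :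
    IsCubeZeroSumOn (m * n) s x := by
  obtain ⟨u, hu, hus⟩ := hm
  obtain ⟨v, hv, hvs⟩ := hn
  have hcop : IsCoprime (m : ℤ) n := Nat.isCoprime_iff_coprime.2 hmn
  obtain ⟨c, d, hcd⟩ := id hcop
  -- the weight `w i` is congruent to `u i` modulo `m` and to `v i` modulo `n`
  let w : ι → ℤ := fun i => u i * (d * n) + v i * (c * m)
  have hwu : ∀ i, w i = u i + m * (c * (v i - u i)) := fun i => by
    simp only [w]; linear_combination u i * hcd
  have hwv : ∀ i, w i = v i + n * (d * (u i - v i)) := fun i => by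
    simp only [w]; linear_combination v i * hcd
  refine ⟨w, fun i hi => ?_, ?_⟩
  · push_cast
    refine IsCoprime.mul_left ?_ ?_
    · rw [hwu]; exact (hu i hi).add_mul_left_right _
    · rw [hwv]; exact (hv i hi).add_mul_left_right _
  · push_cast
    refine hcop.mul_dvd ?_ ?_
    · refine ((Int.ModEq.sum (n := m) fun i _ => ?_).dvd_iff).2 hus
      refine Int.ModEq.mul_right _ (Int.ModEq.pow 3 ?_)
      exact (Int.modEq_iff_dvd.2 ⟨c * (v i - u i), by rw [hwu]; ring⟩).symm
    · refine ((Int.ModEq.sum (n := n) fun i _ => ?_).dvd_iff).2 hvs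
      refine Int.ModEq.mul_right _ (Int.ModEq.pow 3 ?_)
      exact (Int.modEq_iff_dvd.2 ⟨d * (u i - v i), by rw [hwv]; ring⟩).symm

/-- A sequence with enough terms prime to each prime divisor of `n` is, as a whole, a
cube-weighted zero-sum modulo `n`. -/
theorem isCubeZeroSumOn_of_cubeThreshold_le {ι : Type*} {s : Finset ι} {x : ι → ℤ} {n : ℕ}
    (hn : n ≠ 0) (h2 : ¬ 2 ∣ n) (h3 : ¬ 3 ∣ n) (h7 : ¬ 7 ∣ n)
    (h : ∀ p, p.Prime → p ∣ n → cubeThreshold p ≤ {i ∈ s | ¬ (p : ℤ) ∣ x i}.card) :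
    IsCubeZeroSumOn n s x := by
  induction n using Nat.recOnPosPrimePosCoprime with
  | zero => exact absurd rfl hn
  | one => exact ⟨1, by simp [isCoprime_one_left], by simp⟩
  | prime_pow p k hp hk =>
    obtain ⟨k, rfl⟩ : ∃ l, k = l + 1 := ⟨k - 1, by omega⟩
    have hdvd : p ∣ p ^ (k + 1) := dvd_pow_self p k.succ_ne_zero
    have hp3 : p ≠ 3 := by rintro rfl; exact h3 hdvd
    have hle := h p hp hdvd
    have hmod : IsCubeZeroSumOn p s x := isCubeZeroSumOn_prime hp
      (by rintro rfl; exact h2 hdvd) (by rintro rfl; exact h7 hdvd) hle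
    obtain ⟨j, hj⟩ : {i ∈ s | ¬ (p : ℤ) ∣ x i}.Nonempty := by
      refine Finset.card_pos.1 (lt_of_lt_of_le ?_ hle)
      unfold cubeThreshold
      split_ifs <;> norm_num
    rw [Finset.mem_filter] at hj
    exact hmod.prime_pow hp hp3 k hj.1 hj.2
  | coprime a b ha hb hab iha ihb =>
    have hda : a ∣ a * b := Dvd.intro _ rfl
    have hdb : b ∣ a * b := Dvd.intro_left _ rfl
    exact (iha (by omega) (fun h => h2 (h.trans hda)) (fun h => h3 (h.trans hda))
        (fun h => h7 (h.trans hda)) fun p hp hpd => h p hp (hpd.trans hda)).mul_of_coprime hab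
      (ihb (by omega) (fun h => h2 (h.trans hdb)) (fun h => h3 (h.trans hdb))
        (fun h => h7 (h.trans hdb)) fun p hp hpd => h p hp (hpd.trans hdb))

/-! ### Upper bound: removing one prime factor -/

theorem exists_int_modEq_isCoprime {m n : ℕ} (hn : n ≠ 0) (hmn : m ∣ n) {u : ℤ}
    (hu : IsCoprime (m : ℤ) u) : ∃ v : ℤ, v ≡ u [ZMOD m] ∧ IsCoprime (n : ℤ) v := by
  have : NeZero n := ⟨hn⟩
  obtain ⟨U, hU⟩ := (ZMod.coe_int_isUnit_iff_isCoprime u m).2 hu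
  obtain ⟨V, rfl⟩ := ZMod.unitsMap_surjective hmn U
  obtain ⟨v, hv⟩ := ZMod.intCast_surjective (V : ZMod n)
  refine ⟨v, ?_, ?_⟩
  · rw [← ZMod.intCast_eq_intCast_iff, ← hU, ZMod.unitsMap_val, ← hv, ZMod.cast_intCast hmn]
  · rw [← ZMod.coe_int_isUnit_iff_isCoprime, hv]
    exact V.isUnit

theorem IsCubeZeroSumOn.mul_left {ι : Type*} {p n : ℕ} (hpn : p * n ≠ 0) {s : Finset ι}
    {x y : ι → ℤ} (hxy : ∀ i ∈ s, x i = p * y i) (h : IsCubeZeroSumOn n s y) :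
    IsCubeZeroSumOn (p * n) s x := by
  obtain ⟨u, hu, hsum⟩ := h
  have hv : ∀ i, ∃ v : ℤ, i ∈ s → v ≡ u i [ZMOD n] ∧ IsCoprime ((p * n : ℕ) : ℤ) v := by
    intro i
    by_cases hi : i ∈ s
    · obtain ⟨v, hv⟩ := exists_int_modEq_isCoprime hpn (Dvd.intro_left _ rfl) (hu i hi)
      exact ⟨v, fun _ => hv⟩
    · exact ⟨0, fun h => absurd h hi⟩
  choose v hv using hv
  refine ⟨v, fun i hi => (hv i hi).2, ?_⟩
  have h1 : ∑ i ∈ s, v i ^ 3 * x i = p * ∑ i ∈ s, v i ^ 3 * y i := by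
    rw [Finset.mul_sum]
    exact Finset.sum_congr rfl fun i hi => by rw [hxy i hi]; ring
  rw [h1]
  push_cast
  refine mul_dvd_mul_left _ ((Int.ModEq.dvd_iff (n := n) ?_).2 hsum)
  exact Int.ModEq.sum fun i hi => ((hv i hi).1.pow 3).mul_right _

/-- Fewer than `c` exceptional positions among the first `c * M` miss one of the `c` consecutive
blocks of length `M`. -/
theorem exists_block_forall {c M : ℕ} {P : ℕ → Prop} [DecidablePred P]
    (h : {i ∈ Finset.range (c * M) | ¬ P i}.card < c) :
    ∃ j < c, ∀ i < M, P (j * M + i) := by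
  have hlt : ({i ∈ Finset.range (c * M) | ¬ P i}.image (· / M)).card < (Finset.range c).card := by
    rw [Finset.card_range]
    exact Finset.card_image_le.trans_lt h
  obtain ⟨j, hj, hjn⟩ := Finset.exists_mem_notMem_of_card_lt_card hlt
  rw [Finset.mem_range] at hj
  refine ⟨j, hj, fun i hi => ?_⟩
  by_contra hP
  refine hjn (Finset.mem_image.2 ⟨j * M + i, Finset.mem_filter.2 ⟨?_, hP⟩, ?_⟩)
  · rw [Finset.mem_range]
    calc j * M + i < (j + 1) * M := by rw [add_mul]; omega
      _ ≤ c * M := Nat.mul_le_mul_right _ hj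
  · rw [mul_comm, Nat.mul_add_div (by omega), Nat.div_eq_of_lt hi, add_zero]

/-- If fewer than `c` of the first `c * k` terms are prime to `p`, a block of length `k` consists of
multiples of `p`, and dividing it by `p` reduces the problem to the modulus `n`. -/
theorem ForcesCubeZeroSum.exists_of_card_lt {p n k : ℕ} (hpn : p * n ≠ 0)
    (hk : ForcesCubeZeroSum n k) {c : ℕ} {x : ℕ → ℤ}
    (h : {i ∈ Finset.range (c * k) | ¬ (p : ℤ) ∣ x i}.card < c) :
    ∃ a b, a < b ∧ b ≤ c * k ∧ IsCubeZeroSumOn (p * n) (Finset.Ico a b) x := by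
  obtain ⟨j, hj, hdvd⟩ := exists_block_forall h
  obtain ⟨a, b, hab, hbk, hz⟩ := hk fun i => x (j * k + i) / p
  refine ⟨j * k + a, j * k + b, by omega, ?_, ?_⟩
  · calc j * k + b ≤ (j + 1) * k := by rw [add_mul]; omega
      _ ≤ c * k := Nat.mul_le_mul_right _ hj
  · rw [← Finset.map_add_left_Ico]
    refine IsCubeZeroSumOn.map _ (hz.mul_left hpn fun i hi => ?_)
    exact (Int.mul_ediv_cancel' (hdvd i ((Finset.mem_Ico.1 hi).2.trans_le hbk))).symm

/-! ### Lower bound: interleaving sequences without zero-sums -/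

/-- The sequence `x 0, …, x (l - 1), y 0, x 0, …, x (l - 1), y 1, …` with period `l + 1` in which
the entries taken from `x` are multiplied by `p`. -/
def interleave (p l : ℕ) (x y : ℕ → ℤ) (i : ℕ) : ℤ :=
  if i % (l + 1) = l then y (i / (l + 1)) else p * x (i % (l + 1))

theorem interleave_of_lt {p l : ℕ} (x y : ℕ → ℤ) (c : ℕ) {i : ℕ} (hi : i < l) :
    interleave p l x y ((l + 1) * c + i) = p * x i := by
  have h : ((l + 1) * c + i) % (l + 1) = i := by
    rw [Nat.mul_add_mod, Nat.mod_eq_of_lt (by omega)]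
  rw [interleave, h, if_neg hi.ne]

theorem interleave_last (p l : ℕ) (x y : ℕ → ℤ) (c : ℕ) :
    interleave p l x y ((l + 1) * c + l) = y c := by
  have h : ((l + 1) * c + l) % (l + 1) = l := by
    rw [Nat.mul_add_mod, Nat.mod_eq_of_lt (by omega)]
  have h' : ((l + 1) * c + l) / (l + 1) = c := by
    rw [Nat.mul_add_div (by omega), Nat.div_eq_of_lt (by omega), add_zero]
  rw [interleave, h, if_pos rfl, h']

/-- Sequences without zero-sum stretches of lengths `k` modulo `p` and `l` modulo `n` combine to
one of length `(k + 1) * (l + 1) - 1` modulo `p * n`. A stretch containing terms of the first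
sequence is ruled out modulo `p`, since all other terms vanish; one that does not lies inside a
copy of the second. -/
theorem not_forcesCubeZeroSum_mul {p n k l : ℕ} (hp : p ≠ 0) (hk : ¬ ForcesCubeZeroSum p k)
    (hl : ¬ ForcesCubeZeroSum n l) :
    ¬ ForcesCubeZeroSum (p * n) ((k + 1) * (l + 1) - 1) := by
  simp only [ForcesCubeZeroSum, not_forall] at hk hl
  obtain ⟨y, hy⟩ := hk
  obtain ⟨x, hx⟩ := hl
  intro hforce
  obtain ⟨a, b, hab, hbk, u, hu, hsum⟩ := hforce (interleave p l x y)
  have hb1 : b < (k + 1) * (l + 1) := by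
    have : 0 < (k + 1) * (l + 1) := by positivity
    omega
  have hbdiv : b / (l + 1) < k + 1 := (Nat.div_lt_iff_lt_mul (by omega)).2 hb1
  have ha := Nat.div_add_mod a (l + 1)
  have hb := Nat.div_add_mod b (l + 1)
  have ham := Nat.mod_lt a (by omega : 0 < l + 1)
  have hbm := Nat.mod_lt b (by omega : 0 < l + 1)
  rcases (Nat.div_le_div_right hab.le : a / (l + 1) ≤ b / (l + 1)).lt_or_eq with hlt | heq
  · refine hy ⟨a / (l + 1), b / (l + 1), hlt, by omega, fun c => u ((l + 1) * c + l), ?_, ?_⟩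
    · intro c hc
      rw [Finset.mem_Ico] at hc
      have h1 : (l + 1) * (a / (l + 1)) ≤ (l + 1) * c := Nat.mul_le_mul_left _ hc.1
      have h2 : (l + 1) * (c + 1) ≤ (l + 1) * (b / (l + 1)) := Nat.mul_le_mul_left _ hc.2
      rw [mul_add] at h2
      have h := hu ((l + 1) * c + l) (Finset.mem_Ico.2 ⟨by omega, by omega⟩)
      push_cast at h
      exact h.of_mul_left_left
    · have hinj : Function.Injective fun c => (l + 1) * c + l := fun c d h => by
        have : (l + 1) * c = (l + 1) * d := Nat.add_right_cancel h
        exact Nat.eq_of_mul_eq_mul_left (by omega) this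
      have hpsum : (p : ℤ) ∣ ∑ i ∈ Finset.Ico a b, u i ^ 3 * interleave p l x y i :=
        (Dvd.intro _ (by push_cast; rfl)).trans hsum
      have hsub : (Finset.Ico (a / (l + 1)) (b / (l + 1))).image (fun c => (l + 1) * c + l) ⊆
          Finset.Ico a b := by
        intro i hi
        obtain ⟨c, hc, rfl⟩ := Finset.mem_image.1 hi
        rw [Finset.mem_Ico] at hc ⊢
        have h1 : (l + 1) * (a / (l + 1)) ≤ (l + 1) * c := Nat.mul_le_mul_left _ hc.1
        have h2 : (l + 1) * (c + 1) ≤ (l + 1) * (b / (l + 1)) := Nat.mul_le_mul_left _ hc.2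
        rw [mul_add] at h2
        omega
      rw [← Finset.sum_sdiff hsub, Finset.sum_image hinj.injOn] at hpsum
      simp only [interleave_last] at hpsum
      refine (dvd_add_right (Finset.dvd_sum fun i hi => ?_)).1 hpsum
      rw [Finset.mem_sdiff, Finset.mem_Ico] at hi
      have hne : i % (l + 1) ≠ l := by
        intro hil
        have hi' := Nat.div_add_mod i (l + 1)
        rw [hil] at hi'
        refine hi.2 (Finset.mem_image.2 ⟨i / (l + 1), Finset.mem_Ico.2 ⟨?_, ?_⟩, hi'⟩)
        · exact Nat.div_le_div_right hi.1.1
        · rw [← Nat.succ_le_iff, Nat.le_div_iff_mul_le (by omega), Nat.succ_mul, mul_comm]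
          omega
      rw [interleave, if_neg hne]
      exact (Dvd.intro _ rfl).mul_left _
  · set c := a / (l + 1)
    rw [← heq] at hb
    have hIco : Finset.Ico a b =
        (Finset.Ico (a % (l + 1)) (b % (l + 1))).map (addLeftEmbedding ((l + 1) * c)) := by
      rw [Finset.map_add_left_Ico, ha, hb]
    refine hx ⟨a % (l + 1), b % (l + 1), by omega, by omega,
      fun i => u ((l + 1) * c + i), ?_, ?_⟩
    · intro i hi
      have h := hu ((l + 1) * c + i)
        (hIco ▸ Finset.mem_map_of_mem (addLeftEmbedding ((l + 1) * c)) hi)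
      push_cast at h
      exact h.of_mul_left_right
    · rw [hIco, Finset.sum_map] at hsum
      have h1 : ∑ i ∈ Finset.Ico (a % (l + 1)) (b % (l + 1)),
          u (addLeftEmbedding ((l + 1) * c) i) ^ 3 *
            interleave p l x y (addLeftEmbedding ((l + 1) * c) i) =
          p * ∑ i ∈ Finset.Ico (a % (l + 1)) (b % (l + 1)), u ((l + 1) * c + i) ^ 3 * x i := by
        rw [Finset.mul_sum]
        refine Finset.sum_congr rfl fun i hi => ?_
        rw [addLeftEmbedding_apply,
          interleave_of_lt x y c (by have := (Finset.mem_Ico.1 hi).2; omega)]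
        ring
      rw [h1] at hsum
      push_cast at hsum
      exact Int.dvd_of_mul_dvd_mul_left (by exact_mod_cast hp) hsum

theorem not_forcesCubeZeroSum_zero (n : ℕ) : ¬ ForcesCubeZeroSum n 0 := fun h => by
  obtain ⟨a, b, hab, hb, -⟩ := h 0
  omega

/-- The witness is the sequence `1`. -/
theorem not_forcesCubeZeroSum_one {p : ℕ} (hp : p.Prime) : ¬ ForcesCubeZeroSum p 1 := by
  intro h
  obtain ⟨a, b, hab, hb, u, hu, hsum⟩ := h fun _ => 1
  obtain ⟨rfl, rfl⟩ : a = 0 ∧ b = 1 := by omega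
  have h0 := hu 0 (by simp)
  simp only [Nat.Ico_succ_singleton, Finset.sum_singleton, mul_one] at hsum
  exact (Nat.prime_iff_prime_int.1 hp).not_isUnit (h0.pow_right.isUnit_of_dvd' dvd_rfl hsum)

theorem exists_isUnit_not_cube {p : ℕ} [Fact p.Prime] (hp : p ≡ 1 [MOD 3]) :
    ∃ w : (ZMod p)ˣ, ∀ v, v ^ 3 ≠ w := by
  have hpp : p.Prime := Fact.out
  by_contra! hsurj
  have hinj : Function.Injective fun v : (ZMod p)ˣ => v ^ 3 :=
    Finite.injective_iff_surjective.2 hsurj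
  have hdvd : 3 ∣ Nat.card (ZMod p)ˣ := by
    rw [Nat.card_eq_fintype_card, ZMod.card_units]
    exact (Nat.modEq_iff_dvd' hpp.one_le).1 hp.symm
  obtain ⟨g, hg⟩ := exists_prime_orderOf_dvd_card' 3 hdvd
  have : g = 1 := hinj (by simp only [one_pow, ← hg, pow_orderOf_eq_one])
  rw [this, orderOf_one] at hg
  omega

/-- The witness is `1, w` with `w` not a cube modulo `p`: as `-1` is a cube, no combination of the
two terms vanishes. -/
theorem not_forcesCubeZeroSum_two {p : ℕ} (hp : p.Prime) (hp1 : p ≡ 1 [MOD 3]) :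
    ¬ ForcesCubeZeroSum p 2 := by
  have : Fact p.Prime := ⟨hp⟩
  obtain ⟨w, hw⟩ := exists_isUnit_not_cube hp1
  obtain ⟨z, hz⟩ := ZMod.intCast_surjective (w : ZMod p)
  intro h
  obtain ⟨a, b, hab, hb, u, hu, hsum⟩ := h fun i => if i = 0 then 1 else z
  have hu' : ∀ i ∈ Finset.Ico a b, (u i : ZMod p) ≠ 0 := fun i hi =>
    ((ZMod.coe_int_isUnit_iff_isCoprime _ _).2 (hu i hi)).ne_zero
  rw [← ZMod.intCast_zmod_eq_zero_iff_dvd] at hsum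
  obtain ⟨rfl, rfl⟩ | ⟨rfl, rfl⟩ | ⟨rfl, rfl⟩ :
      (a = 0 ∧ b = 1) ∨ (a = 1 ∧ b = 2) ∨ (a = 0 ∧ b = 2) := by omega
  · simp at hsum
    exact hu' 0 (by simp) hsum
  · simp [hz] at hsum
    exact hu' 1 (by simp) hsum
  · simp only [Nat.Ico_zero_eq_range, Finset.sum_range_succ, Finset.sum_range_zero, if_true,
      one_ne_zero, if_false, zero_add, mul_one] at hsum
    push_cast at hsum
    rw [hz] at hsum
    have h0 := hu' 0 (by simp)
    have h1 := hu' 1 (by simp)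
    refine hw (Units.mk0 (-(u 0 / u 1 : ZMod p)) (neg_ne_zero.2 (div_ne_zero h0 h1)))
      (Units.ext ?_)
    rw [Units.val_pow_eq_pow_val, Units.val_mk0]
    field_simp
    linear_combination -hsum

/-- The witness is `1, 3, 1`: the cubes of units modulo `7` are `1` and `-1`. -/
theorem not_forcesCubeZeroSum_seven : ¬ ForcesCubeZeroSum 7 3 := by
  intro h
  obtain ⟨a, b, hab, hb, hz⟩ := h fun i => if i = 1 then 3 else 1
  obtain ⟨w, hw, hsum⟩ := (isWeightedZeroSumOn_unitPowers_iff 7 _ _).2 hz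
  have hcube : ∀ v : (ZMod 7)ˣ, (v : ZMod 7) ^ 3 = 1 ∨ (v : ZMod 7) ^ 3 = -1 := by decide
  obtain ⟨e, he, hsum⟩ : ∃ e : ℕ → ZMod 7, (∀ i, e i = 1 ∨ e i = -1) ∧
      ∑ i ∈ Finset.Ico a b, e i * (if i = 1 then 3 else 1) = 0 := by
    refine ⟨fun i => if i ∈ Finset.Ico a b then w i else 1, fun i => ?_, ?_⟩
    · dsimp only
      split_ifs with hi
      · obtain ⟨v, hv⟩ := hw i hi
        rw [hv]
        exact hcube v
      · exact Or.inl rfl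
    · rw [← hsum]
      exact Finset.sum_congr rfl fun i hi => by simp [Finset.mem_Ico.1 hi]
  obtain ⟨rfl, rfl⟩ | ⟨rfl, rfl⟩ | ⟨rfl, rfl⟩ | ⟨rfl, rfl⟩ | ⟨rfl, rfl⟩ | ⟨rfl, rfl⟩ :
      (a = 0 ∧ b = 1) ∨ (a = 1 ∧ b = 2) ∨ (a = 2 ∧ b = 3) ∨ (a = 0 ∧ b = 2) ∨ (a = 1 ∧ b = 3) ∨
        (a = 0 ∧ b = 3) := by omega
  all_goals
    rw [Finset.sum_Ico_eq_sum_range] at hsum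
    simp only [Finset.sum_range_succ, Finset.sum_range_zero] at hsum
    rcases he 0 with h0 | h0 <;> rcases he 1 with h1 | h1 <;> rcases he 2 with h2 | h2 <;>
      simp only [h0, h1, h2, zero_add, add_zero, Nat.reduceAdd] at hsum <;>
      revert hsum <;> decide

/-! ### The part of `n` supported on primes congruent to `1` modulo `3` -/

theorem oneModThreePart_eq_prod (n : ℕ) :
    oneModThreePart n = n.factorization.prod fun p v => if p ≡ 1 [MOD 3] then p ^ v else 1 := by
  rw [oneModThreePart, Finset.prod_filter]
  rfl

theorem oneModThreePart_one : oneModThreePart 1 = 1 := by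
  simp [oneModThreePart]

theorem oneModThreePart_ne_zero (n : ℕ) : oneModThreePart n ≠ 0 :=
  Finset.prod_ne_zero_iff.2 fun _ hp =>
    pow_ne_zero _ (Nat.prime_of_mem_primeFactors (Finset.mem_filter.1 hp).1).ne_zero

theorem oneModThreeCoPart_ne_zero {n : ℕ} (hn : n ≠ 0) : oneModThreeCoPart n ≠ 0 := by
  intro h
  rw [← oneModThreePart_mul_coPart n, h, mul_zero] at hn
  exact hn rfl

theorem oneModThreePart_prime_mul {p n : ℕ} (hp : p.Prime) (hn : n ≠ 0) :
    oneModThreePart (p * n) = (if p ≡ 1 [MOD 3] then p else 1) * oneModThreePart n := by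
  simp only [oneModThreePart_eq_prod]
  rw [Nat.factorization_mul hp.ne_zero hn, Finsupp.prod_add_index', hp.factorization,
    Finsupp.prod_single_index]
  · simp
  · simp
  · simp
  · intro q v w
    split_ifs
    · exact pow_add _ _ _
    · simp

theorem oneModThreeCoPart_prime_mul {p n : ℕ} (hp : p.Prime) (hn : n ≠ 0) :
    oneModThreeCoPart (p * n) = (if p ≡ 1 [MOD 3] then 1 else p) * oneModThreeCoPart n := by
  have h1 := oneModThreePart_mul_coPart (p * n)
  refine Nat.eq_of_mul_eq_mul_left (Nat.pos_of_ne_zero (oneModThreePart_ne_zero (p * n))) ?_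
  rw [h1, oneModThreePart_prime_mul hp hn]
  nth_rewrite 1 [← oneModThreePart_mul_coPart n]
  split_ifs <;> ring

/-- The number `2 ^ Ω(n₂) * d ^ Ω(n₁)`; the bounds are the cases `d = 3` and `d = 4`. -/
def cubeBound (d n : ℕ) : ℕ :=
  2 ^ ArithmeticFunction.cardFactors (oneModThreeCoPart n) *
    d ^ ArithmeticFunction.cardFactors (oneModThreePart n)

theorem cubeBound_one (d : ℕ) : cubeBound d 1 = 1 := by
  simp [cubeBound, oneModThreeCoPart, oneModThreePart_one]

theorem cubeBound_pos {d : ℕ} (hd : 0 < d) (n : ℕ) : 0 < cubeBound d n := by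
  unfold cubeBound
  positivity

theorem cubeBound_prime_mul (d : ℕ) {p n : ℕ} (hp : p.Prime) (hn : n ≠ 0) :
    cubeBound d (p * n) = (if p ≡ 1 [MOD 3] then d else 2) * cubeBound d n := by
  have h1 := oneModThreePart_ne_zero n
  have h2 := oneModThreeCoPart_ne_zero hn
  rw [cubeBound, oneModThreePart_prime_mul hp hn, oneModThreeCoPart_prime_mul hp hn, cubeBound]
  split_ifs
  · rw [one_mul, ArithmeticFunction.cardFactors_mul hp.ne_zero h1,
      ArithmeticFunction.cardFactors_apply_prime hp]
    ring
  · rw [one_mul, ArithmeticFunction.cardFactors_mul hp.ne_zero h2,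
      ArithmeticFunction.cardFactors_apply_prime hp]
    ring

/-! ### The bounds -/

theorem forcesCubeZeroSum_cubeBound {n : ℕ} (h2 : ¬ 2 ∣ n) (h3 : ¬ 3 ∣ n) (h7 : ¬ 7 ∣ n) :
    ForcesCubeZeroSum n (cubeBound 4 n) := by
  induction n using Nat.strong_induction_on with
  | _ n ih =>
    intro x
    have hn : n ≠ 0 := by rintro rfl; exact h2 (dvd_zero 2)
    by_cases h : ∀ p, p.Prime → p ∣ n →
        cubeThreshold p ≤ {i ∈ Finset.Ico 0 (cubeBound 4 n) | ¬ (p : ℤ) ∣ x i}.card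
    · refine ⟨0, cubeBound 4 n, ?_, le_rfl, isCubeZeroSumOn_of_cubeThreshold_le hn h2 h3 h7 h⟩
      exact cubeBound_pos four_pos n
    · push Not at h
      obtain ⟨p, hp, ⟨m, rfl⟩, hlt⟩ := h
      have hm : m ≠ 0 := right_ne_zero_of_mul hn
      have hdvd : m ∣ p * m := Dvd.intro_left _ rfl
      have hmlt : m < p * m := lt_mul_of_one_lt_left (Nat.pos_of_ne_zero hm) hp.one_lt
      have hIH := ih m hmlt (fun h => h2 (h.trans hdvd)) (fun h => h3 (h.trans hdvd))
        (fun h => h7 (h.trans hdvd))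
      have hb : cubeBound 4 (p * m) = cubeThreshold p * cubeBound 4 m :=
        cubeBound_prime_mul 4 hp hm
      rw [hb] at hlt ⊢
      rw [Nat.Ico_zero_eq_range] at hlt
      exact hIH.exists_of_card_lt hn hlt

theorem not_forcesCubeZeroSum_cubeBound {n : ℕ} (hn : n ≠ 0) :
    ¬ ForcesCubeZeroSum n (cubeBound 3 n - 1) := by
  induction n using induction_on_primes with
  | zero => exact absurd rfl hn
  | one => rw [cubeBound_one]; exact not_forcesCubeZeroSum_zero 1
  | prime_mul p m hp ih =>
    have hm : m ≠ 0 := right_ne_zero_of_mul hn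
    have hpos := cubeBound_pos three_pos m
    rw [cubeBound_prime_mul 3 hp hm]
    split_ifs with h1
    · have := not_forcesCubeZeroSum_mul hp.ne_zero (not_forcesCubeZeroSum_two hp h1) (ih hm)
      rwa [Nat.sub_add_cancel hpos] at this
    · have := not_forcesCubeZeroSum_mul hp.ne_zero (not_forcesCubeZeroSum_one hp) (ih hm)
      rwa [Nat.sub_add_cancel hpos] at this

theorem not_forcesCubeZeroSum_seven_pow_mul {n : ℕ} (hn : n ≠ 0) (r : ℕ) :
    ¬ ForcesCubeZeroSum (7 ^ r * n) (cubeBound 3 n * 4 ^ r - 1) := by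
  induction r with
  | zero => simpa using not_forcesCubeZeroSum_cubeBound hn
  | succ r ih =>
    have hpos : 1 ≤ cubeBound 3 n * 4 ^ r := Nat.mul_pos (cubeBound_pos three_pos n) (by positivity)
    have := not_forcesCubeZeroSum_mul (by norm_num) not_forcesCubeZeroSum_seven ih
    rw [Nat.sub_add_cancel hpos] at this
    have h1 : 7 ^ (r + 1) * n = 7 * (7 ^ r * n) := by ring
    have h2 : cubeBound 3 n * 4 ^ (r + 1) = (3 + 1) * (cubeBound 3 n * 4 ^ r) := by ring
    rwa [h1, h2]

theorem ForcesCubeZeroSum.mono {n k l : ℕ} (hkl : k ≤ l) (h : ForcesCubeZeroSum n k) :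
    ForcesCubeZeroSum n l := fun x => by
  obtain ⟨a, b, hab, hb, hz⟩ := h x
  exact ⟨a, b, hab, hb.trans hkl, hz⟩

theorem theorem6p8 :
    (∀ n : ℕ, ¬ 2 ∣ n → ¬ 3 ∣ n → ¬ 7 ∣ n →
      weightedC (unitPowers n 3) (ZMod n) ≤
        2 ^ ArithmeticFunction.cardFactors (oneModThreeCoPart n) *
          4 ^ ArithmeticFunction.cardFactors (oneModThreePart n)) ∧
    (∀ r n m : ℕ, ¬ 7 ∣ n → m = 7 ^ r * n →
      2 ^ ArithmeticFunction.cardFactors (oneModThreeCoPart n) *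
          3 ^ ArithmeticFunction.cardFactors (oneModThreePart n) * 4 ^ r ≤
        weightedC (unitPowers m 3) (ZMod m)) := by
  constructor
  · intro n h2 h3 h7
    have : NeZero n := ⟨by rintro rfl; exact h2 (dvd_zero 2)⟩
    exact (weightedC_unitPowers_isLeast n).2
      ⟨cubeBound_pos four_pos n, forcesCubeZeroSum_cubeBound h2 h3 h7⟩
  · rintro r n m h7 rfl
    have hn : n ≠ 0 := by rintro rfl; exact h7 (dvd_zero 7)
    have : NeZero (7 ^ r * n) := ⟨mul_ne_zero (by positivity) hn⟩
    by_contra! hlt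
    have hforce := (weightedC_unitPowers_isLeast (7 ^ r * n)).1.2
    exact not_forcesCubeZeroSum_seven_pow_mul hn r (hforce.mono (Nat.le_sub_one_of_lt hlt))
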